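/- Let $Y$ be a smooth complex variety (an integral separated scheme of finite type, smooth over $\mathbb C$; all topological notions below refer to the classical topology on complex points). Let $B_1,B_2$ be reduced (effective, possibly zero) divisors on $Y$, identified with their supports, and let $G$ be a finite group. For $i=1,2$ fix a base point $y_i\in Y\setminus B_i$ and a surjective homomorphism $\theta_i:\pi_1(Y\setminus B_i,y_i)\twoheadrightarrow G$, and let $\phi_i:X_i\to Y$ be the $G$-cover induced by $\theta_i$, that is, $X_i$ is a normal complex variety, $\phi_i$ is a finite morphism, and over $Y\setminus B_i$ it restricts to the connected covering corresponding to the normal subgroup $\ker\theta_i$ of $\pi_1(Y\setminus B_i,y_i)$. For a subset $C\subset Y$ let $c_{\phi_i}(C)$, the connected number of $C$ for $\phi_i$, denote the number of connected components of $\phi_i^{-1}(C\setminus B_i)$. Let $C_1\subset Y$ be an algebraic subset (a Zariski closed set) such that no irreducible component of $C_1$ is contained in $B_1$ and $C_1\setminus B_1$ is connected. Assume that there exist a homeomorphism $h:Y\to Y$ with $h(B_1)=B_2$ and an automorphism $\sigma:G\to G$ such that $\sigma\circ\theta_2\circ h_*=\theta_1$, where $h_*:\pi_1(Y\setminus B_1,y_1)\to\pi_1(Y\setminus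 B_2,y_2)$ is induced by $h$, the base point $h(y_1)$ being moved to $y_2$ along some path in $Y\setminus B_2$. Then $c_{\phi_1}(C_1)=c_{\phi_2}(C_2)$, where $C_2=h(C_1)$. -/

import Mathlib

open CategoryTheory AlgebraicGeometry

noncomputable section

namespace ConnectedNumber

/-- The base scheme `Spec ℂ`. -/
abbrev SpecC : Scheme.{0} := Spec (.of ℂ)

/-- A complex variety: an integral separated scheme of finite type over `ℂ`. -/
class IsVariety (X : Scheme.{0}) [X.Over SpecC] : Prop extends
  IsIntegral X, IsSeparated (X ↘ SpecC), LocallyOfFiniteType (X ↘ SpecC),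
  QuasiCompact (X ↘ SpecC)

section Points

variable (X : Scheme.{0}) [X.Over SpecC]

/-- The set `X(ℂ)` of complex points of a `ℂ`-scheme. -/
def CPoints : Type := {p : SpecC ⟶ X // p ≫ (X ↘ SpecC) = 𝟙 SpecC}

variable {X}

/-- The (closed) point of the underlying Zariski space of `X` at which a complex point lies. -/
def CPoints.pt (p : CPoints X) : X := p.1 (IsLocalRing.closedPoint ℂ)

/-- The value in `ℂ` of a regular function `f` on a `ℂ`-scheme at a complex point
`q : Spec ℂ ⟶ U`. -/
def value {U : Scheme.{0}} (f : Γ(U, ⊤)) (q : SpecC ⟶ U) : ℂ :=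
  (Scheme.ΓSpecIso (.of ℂ)).hom (q.appTop f)

/-- For a regular function `f` on a Zariski open `U ⊆ X` and `V ⊆ ℂ`, the set of complex points
of `X` that lie in `U` and at which `f` takes a value in `V`. -/
def basicSet (U : X.Opens) (f : Γ(U.toScheme, ⊤)) (V : Set ℂ) : Set (CPoints X) :=
  {p | ∃ q : SpecC ⟶ U.toScheme, q ≫ U.ι = p.1 ∧ value f q ∈ V}

/-- The classical (analytic) topology on `X(ℂ)`: the coarsest topology for which `U(ℂ)` is open
for every Zariski open `U ⊆ X` and every regular function on `U` is continuous on `U(ℂ)`, where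
`ℂ` carries its usual topology. -/
instance : TopologicalSpace (CPoints X) :=
  TopologicalSpace.generateFrom
    {S | ∃ (U : X.Opens) (f : Γ(U.toScheme, ⊤)) (V : Set ℂ), IsOpen V ∧ S = basicSet U f V}

/-- The complex points lying in a subset of the underlying Zariski space of `X`. -/
def cset (C : Set X) : Set (CPoints X) := {p | p.pt ∈ C}

/-- The map `X(ℂ) → Y(ℂ)` induced by a morphism of `ℂ`-schemes. -/
def CPoints.map {Y : Scheme.{0}} [Y.Over SpecC] (φ : X ⟶ Y) [φ.IsOver SpecC] (p : CPoints X) :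
    CPoints Y :=
  ⟨p.1 ≫ φ, by rw [Category.assoc, comp_over]; exact p.2⟩

end Points

/-- `Z` is an irreducible component of the subset `C` of a topological space. -/
def IsIrreducibleComponentOf {T : Type*} [TopologicalSpace T] (Z C : Set T) : Prop :=
  Maximal (fun s => IsIrreducible s ∧ s ⊆ C) Z

/-- A reduced (effective, possibly zero) divisor on `Y`: a finite set of prime divisors, each given
by its generic point, a point of codimension one. -/
structure ReducedDivisor (Y : Scheme.{0}) where
  components : Set Y
  finite : components.Finite
  codim_one : ∀ η ∈ components, Order.coheight η = 1

section Divisor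

variable {X Y : Scheme.{0}} [X.Over SpecC] [Y.Over SpecC]

/-- The support of a reduced divisor, the union of its prime components. -/
def ReducedDivisor.support (B : ReducedDivisor Y) : Set Y := ⋃ η ∈ B.components, closure {η}

/-- The complex points of (the support of) a reduced divisor. -/
def ReducedDivisor.points (B : ReducedDivisor Y) : Set (CPoints Y) := cset B.support

/-- `Y(ℂ) ∖ B`, with the subspace topology. -/
abbrev ReducedDivisor.Compl (B : ReducedDivisor Y) : Type := {p : CPoints Y // p ∉ B.points}

/-- `X(ℂ) ∖ φ⁻¹(B)`, with the subspace topology. -/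
abbrev ReducedDivisor.ComplOver (B : ReducedDivisor Y) (φ : X ⟶ Y) [φ.IsOver SpecC] : Type :=
  {p : CPoints X // p.map φ ∉ B.points}

/-- The restriction `X(ℂ) ∖ φ⁻¹(B) → Y(ℂ) ∖ B` of `φ`. -/
def ReducedDivisor.restrict (B : ReducedDivisor Y) (φ : X ⟶ Y) [φ.IsOver SpecC] :
    B.ComplOver φ → B.Compl :=
  fun p => ⟨p.1.map φ, p.2⟩

/-- `φ : X ⟶ Y` is the (branched) `G`-cover of `Y` induced by `θ : π₁(Y ∖ B, y) → G`, a
surjection onto the finite group `G`: the variety `X` is normal, `φ` is finite, and over `Y ∖ B` the map `φ` is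
the connected covering which corresponds to the normal subgroup `ker θ` of `π₁(Y ∖ B, y)` (whose
group of deck transformations is `π₁(Y ∖ B, y) / ker θ ≅ G`). -/
structure IsInducedCover {G : Type*} [Group G] (φ : X ⟶ Y) [φ.IsOver SpecC]
    (B : ReducedDivisor Y) {y : B.Compl} (θ : FundamentalGroup B.Compl y →* G) : Prop where
  isVariety : IsVariety X
  isNormal : ∀ x : X, IsIntegrallyClosed (X.presheaf.stalk x)
  isFinite : IsFinite φ
  isCoveringMap : IsCoveringMap (B.restrict φ)
  pathConnectedSpace : PathConnectedSpace (B.ComplOver φ)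
  exists_range_eq_ker : ∃ (x : B.ComplOver φ) (hx : B.restrict φ x = y),
    (FundamentalGroup.mapOfEq ⟨B.restrict φ, isCoveringMap.continuous⟩ hx).range = θ.ker

/-- The connected number `c_φ(C)` of a set `C` of complex points of `Y`, for a cover `φ` with
branch divisor contained in `B`: the number of connected components, in the classical topology, of
`φ⁻¹(C ∖ B)`. -/
def connectedNumber (φ : X ⟶ Y) [φ.IsOver SpecC] (B : ReducedDivisor Y) (C : Set (CPoints Y)) :
    ℕ∞ :=
  ENat.card (ConnectedComponents (CPoints.map φ ⁻¹' (C \ B.points) : Set (CPoints X)))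

/-- The map `Y ∖ B₁ → Y ∖ B₂` obtained by restricting a homeomorphism `h` of `Y(ℂ)` with
`h(B₁) = B₂`. -/
def restrictCompl (h : CPoints Y ≃ₜ CPoints Y) {B₁ B₂ : ReducedDivisor Y}
    (hB : h '' B₁.points = B₂.points) : C(B₁.Compl, B₂.Compl) where
  toFun p := ⟨h p.1, fun hp => p.2 <| by
    rw [← hB] at hp
    exact h.injective.mem_set_image.mp hp⟩
  continuous_toFun := (h.continuous.comp continuous_subtype_val).subtype_mk _

/-- The homomorphism `h_* : π₁(Y ∖ B₁, y₁) → π₁(Y ∖ B₂, y₂)` induced by a homeomorphism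
`h` with `h(B₁) = B₂`, where the base point `h(y₁)` is moved to `y₂` along a path `γ`. -/
def inducedHom (h : CPoints Y ≃ₜ CPoints Y) {B₁ B₂ : ReducedDivisor Y}
    (hB : h '' B₁.points = B₂.points) {y₁ : B₁.Compl} {y₂ : B₂.Compl}
    (γ : Path (restrictCompl h hB y₁) y₂) :
    FundamentalGroup B₁.Compl y₁ →* FundamentalGroup B₂.Compl y₂ :=
  (FundamentalGroup.fundamentalGroupMulEquivOfPath γ).toMonoidHom.comp
    (FundamentalGroup.map (restrictCompl h hB) y₁)

end Divisor

end ConnectedNumber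

end

/-! Since `σ` is injective, `σ ∘ θ₂ ∘ h_* = θ₁` says that a loop lies in `ker θ₁` exactly when its
image under `h_*` lies in `ker θ₂`. These kernels are the subgroups of the two unbranched coverings,
so covering theory lifts `h` to a homeomorphism `F` between them
(`IsCoveringMap.exists_homeomorph_of_mem_range_iff`, `IsInducedCover.exists_homeomorph`). As `F`
lies over `h`, it carries the preimage of `C₁ ∖ B₁` onto that of `h(C₁) ∖ B₂`, and the component
counts agree (`connectedNumber_eq_of_homeomorph`).

Lifting maps to coverings requires locally path connected sources. For `Y(ℂ)` this comes from
smoothness (`locallyPathConnectedSpace_cPoints`): a standard smooth chart is a zero set with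
surjective derivative, to which the implicit function theorem applies. The property passes to open
subsets and to coverings. -/

open Topology Filter

/-! ### Local path connectedness through local retracts. -/

/-- A space is locally path connected if near every point it is a continuous local retract of a
locally path connected space. -/
theorem LocallyPathConnectedSpace.of_local_retract {X : Type*} [TopologicalSpace X]
    (H : ∀ x : X, ∃ (Z : Type) (_ : TopologicalSpace Z) (_ : LocallyPathConnectedSpace Z)
      (f : X → Z) (g : Z → X) (D : Set Z), D ∈ 𝓝 (f x) ∧ ContinuousOn g D ∧ ContinuousAt f x ∧
        ∀ᶠ y in 𝓝 x, g (f y) = y) : LocallyPathConnectedSpace X := by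
  rw [locallyPathConnectedSpace_iff_pathComponentIn_mem_nhds]
  intro x u hu hx
  obtain ⟨Z, _, _, f, g, D, hD, hg, hf, hgf⟩ := H x
  have h1 : g ⁻¹' u ∈ 𝓝 (f x) := by
    refine (hg.continuousAt hD).preimage_mem_nhds ?_
    rw [hgf.self_of_nhds]
    exact hu.mem_nhds hx
  obtain ⟨N, ⟨hN, hNp⟩, hNs⟩ :=
    (LocallyPathConnectedSpace.path_connected_basis (f x)).mem_iff.1 (inter_mem hD h1)
  have hp : IsPathConnected (g '' N) := hNp.image' (hg.mono fun z hz => (hNs hz).1)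
  refine mem_of_superset (inter_mem (hf hN) hgf) ?_
  rintro y ⟨hy, hy'⟩
  refine hp.subset_pathComponentIn (x := x) ⟨f x, mem_of_mem_nhds hN, hgf.self_of_nhds⟩ ?_
    ⟨f y, hy, hy'⟩
  rintro _ ⟨z, hz, rfl⟩
  exact (hNs hz).2

theorem IsLocalHomeomorph.locallyPathConnectedSpace {E X : Type} [TopologicalSpace E]
    [TopologicalSpace X] [LocallyPathConnectedSpace X] {p : E → X} (hp : IsLocalHomeomorph p) :
    LocallyPathConnectedSpace E := by
  refine .of_local_retract fun x => ?_
  obtain ⟨e, hx, -⟩ := hp x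
  refine ⟨X, _, inferInstance, e, e.symm, e.target, e.open_target.mem_nhds (e.map_source hx),
    e.continuousOn_symm, e.continuousAt hx, ?_⟩
  filter_upwards [e.open_source.mem_nhds hx] with y hy using e.left_inv hy

/-! ### Coverings: subgroups of the fundamental group, monodromy and lifts. -/

namespace IsCoveringMap

variable {E E' A X : Type*} [TopologicalSpace E] [TopologicalSpace E'] [TopologicalSpace A]
  [TopologicalSpace X] {p : E → X} {q : E' → X}

/-- A loop comes from the total space exactly when its lift at `e` closes up. Monodromy makes
changes of base point easy to track. -/
theorem mem_range_mapOfEq_iff (cov : IsCoveringMap p) {e : E} {x : X} (he : p e = x)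
    (α : FundamentalGroup X x) :
    α ∈ (FundamentalGroup.mapOfEq ⟨p, cov.continuous⟩ he).range ↔
      cov.monodromy α ⟨e, he⟩ = ⟨e, he⟩ := by
  constructor
  · rintro ⟨β, rfl⟩
    refine cov.monodromy_eq_of_map_eq β ?_
    rw [FundamentalGroup.mapOfEq_apply]
    subst he
    exact ((Path.Homotopic.Quotient.cast_rfl_rfl _).trans
      (Path.Homotopic.Quotient.cast_rfl_rfl _)).symm
  · intro h
    refine ⟨(cov.liftPathQuotient α ⟨e, he⟩).cast rfl congr($h.symm.1), ?_⟩
    rw [FundamentalGroup.mapOfEq_apply, Path.Homotopic.Quotient.map_cast,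
      IsCoveringMap.map_liftPathQuotient]
    subst he
    exact (Path.Homotopic.Quotient.cast_cast ..).trans
      ((Path.Homotopic.Quotient.cast_cast ..).trans (Path.Homotopic.Quotient.cast_rfl_rfl _))

theorem exists_lift_of_monodromy_eq [PathConnectedSpace A] [LocallyPathConnectedSpace A]
    (cov : IsCoveringMap p) (f : C(A, X)) (a : A) (e : E) {x : X} (ha : f a = x) (he : p e = x)
    (H : ∀ α : FundamentalGroup X x, α ∈ (FundamentalGroup.mapOfEq f ha).range →
      cov.monodromy α ⟨e, he⟩ = ⟨e, he⟩) :
    ∃ F : C(A, E), F a = e ∧ p ∘ F = f := by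
  subst ha
  refine (cov.existsUnique_continuousMap_lifts_of_range_le he ?_).exists
  rintro _ ⟨β, rfl⟩
  rw [mem_range_mapOfEq_iff]
  refine H _ ⟨β, ?_⟩
  rw [FundamentalGroup.mapOfEq_apply, FundamentalGroup.map_apply]
  exact Path.Homotopic.Quotient.cast_rfl_rfl _

theorem exists_homeomorph_of_monodromy_iff [PathConnectedSpace E] [LocallyPathConnectedSpace E]
    [PathConnectedSpace E'] [LocallyPathConnectedSpace E'] (hp : IsCoveringMap p)
    (hq : IsCoveringMap q) {x : X} (e : p ⁻¹' {x}) (e' : q ⁻¹' {x})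
    (H : ∀ α : FundamentalGroup X x, hp.monodromy α e = e ↔ hq.monodromy α e' = e') :
    ∃ F : E ≃ₜ E', ∀ z, q (F z) = p z := by
  obtain ⟨F, hF, hF'⟩ := hq.exists_lift_of_monodromy_eq ⟨p, hp.continuous⟩ e.1 e'.1 e.2 e'.2
    fun α hα => (H α).1 ((hp.mem_range_mapOfEq_iff e.2 α).1 hα)
  obtain ⟨K, hK, hK'⟩ := hp.exists_lift_of_monodromy_eq ⟨q, hq.continuous⟩ e'.1 e.1 e'.2 e.2
    fun α hα => (H α).2 ((hq.mem_range_mapOfEq_iff e'.2 α).1 hα)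
  -- Both composites lift a projection through itself and fix one point, so unique lifting on a
  -- connected space makes them identities.
  refine ⟨⟨⟨F, K, congrFun (hp.eq_of_comp_eq (K.continuous.comp F.continuous) continuous_id ?_ e.1
    (by simp [hF, hK])), congrFun (hq.eq_of_comp_eq (F.continuous.comp K.continuous) continuous_id
    ?_ e'.1 (by simp [hF, hK]))⟩, F.continuous, K.continuous⟩, congrFun hF'⟩
  · ext z
    exact (congrFun hK' (F z)).trans (congrFun hF' z)
  · ext z
    exact (congrFun hF' (K z)).trans (congrFun hK' z)

end IsCoveringMap

namespace IsCoveringMap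

variable {E E' X X' : Type*} [TopologicalSpace E] [TopologicalSpace E']
  [TopologicalSpace X] [TopologicalSpace X'] {p : E → X} {q : E' → X'}

theorem monodromy_symm_apply (cov : IsCoveringMap p) {x y : X} (γ : Path x y) (e : p ⁻¹' {y}) :
    cov.monodromy (.mk γ) (cov.monodromy (.mk γ.symm) e) = e := by
  rw [← monodromy_trans_apply, ← Path.Homotopic.Quotient.mk_trans,
    ← Path.Homotopic.Quotient.eq.2 ⟨.reflSymmTrans γ⟩, Path.Homotopic.Quotient.mk_refl,
    monodromy_refl]
  rfl

theorem monodromy_fundamentalGroupMulEquivOfPath (cov : IsCoveringMap p) {x y : X} (γ : Path x y)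
    (α : FundamentalGroup X x) (e : p ⁻¹' {y}) :
    cov.monodromy (FundamentalGroup.fundamentalGroupMulEquivOfPath γ α) e =
      cov.monodromy (.mk γ) (cov.monodromy α (cov.monodromy (.mk γ.symm) e)) := by
  rw [← monodromy_trans_apply, ← monodromy_trans_apply]
  rfl

/-- A lift of a path through `p` is also a lift of its `k`-image through `k ∘ p`. -/
theorem monodromy_homeomorph_comp (hp : IsCoveringMap p) (k : X ≃ₜ X')
    (hkp : IsCoveringMap (k ∘ p)) {x y : X} (α : Path.Homotopic.Quotient x y) (e : p ⁻¹' {x}) :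
    (hkp.monodromy (α.map (k : C(X, X'))) ⟨e, congrArg k e.2⟩).1 = (hp.monodromy α e).1 := by
  have h : hkp.monodromy (α.map (k : C(X, X'))) ⟨e, congrArg k e.2⟩ =
      ⟨(hp.monodromy α e).1, congrArg k (hp.monodromy α e).2⟩ := by
    refine hkp.monodromy_eq_of_map_eq (hp.liftPathQuotient α e) ?_
    have h1 := congrArg (fun β => Path.Homotopic.Quotient.map β (k : C(X, X')))
      (hp.map_liftPathQuotient α e)
    refine Eq.trans ?_ (h1.trans (Path.Homotopic.Quotient.map_cast _))
    rw [← Path.Homotopic.Quotient.map_comp]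
    rfl
  exact congrArg Subtype.val h

/-- Two connected covering spaces of homeomorphic spaces are homeomorphic, compatibly with the
projections, if the homeomorphism matches the subgroups of the fundamental groups. -/
theorem exists_homeomorph_of_mem_range_iff [PathConnectedSpace E] [LocallyPathConnectedSpace E]
    [PathConnectedSpace E'] [LocallyPathConnectedSpace E'] (hp : IsCoveringMap p)
    (hq : IsCoveringMap q) (k : X ≃ₜ X') {e : E} {e' : E'} {x : X} {x' : X'} (he : p e = x)
    (he' : q e' = x') (γ : Path (k x) x')
    (H : ∀ α : FundamentalGroup X x,
      α ∈ (FundamentalGroup.mapOfEq ⟨p, hp.continuous⟩ he).range ↔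
      FundamentalGroup.fundamentalGroupMulEquivOfPath γ
          (FundamentalGroup.map (k : C(X, X')) x α) ∈
        (FundamentalGroup.mapOfEq ⟨q, hq.continuous⟩ he').range) :
    ∃ F : E ≃ₜ E', ∀ z, q (F z) = k (p z) := by
  -- Replacing `p` by `k ∘ p` puts both coverings over `X'`; `e'` is then transported back along `γ`
  -- into the fibre over `k x`.
  have hkp : IsCoveringMap (k ∘ p) := by
    rw [isCoveringMap_iff_isCoveringMapOn_univ] at hp ⊢
    simpa using hp.homeomorph_comp k
  refine hkp.exists_homeomorph_of_monodromy_iff hq (x := k x) ⟨e, congrArg k he⟩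
    (hq.monodromy (.mk γ.symm) ⟨e', he'⟩) fun β => ?_
  obtain ⟨α, rfl⟩ : ∃ α : FundamentalGroup X x, FundamentalGroup.map (k : C(X, X')) x α = β := by
    obtain ⟨δ⟩ := β
    refine ⟨FundamentalGroup.fromPath (.mk ((δ.map k.symm.continuous).cast
      (k.symm_apply_apply x).symm (k.symm_apply_apply x).symm)), ?_⟩
    refine congrArg Path.Homotopic.Quotient.mk ?_
    ext t
    exact k.apply_symm_apply _
  have h1 := H α
  rw [hp.mem_range_mapOfEq_iff, hq.mem_range_mapOfEq_iff,
    monodromy_fundamentalGroupMulEquivOfPath] at h1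
  have h2 := hp.monodromy_homeomorph_comp k hkp α ⟨e, he⟩
  have h3 : hkp.monodromy (FundamentalGroup.map (k : C(X, X')) x α) ⟨e, congrArg k he⟩ =
      ⟨e, congrArg k he⟩ ↔ hp.monodromy α ⟨e, he⟩ = ⟨e, he⟩ := by
    rw [Subtype.ext_iff, Subtype.ext_iff]
    exact Eq.congr_left h2
  rw [h3, h1]
  -- With `e'` written as a transport along `γ`, injectivity of that transport cancels it on both
  -- sides.
  conv_lhs => rhs; rw [← hq.monodromy_symm_apply γ ⟨e', he'⟩]
  exact (hq.monodromy_bijective _).1.eq_iff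

end IsCoveringMap

/-! ### Lifting `h` to the covers and comparing components. -/

namespace ConnectedNumber

theorem isOpen_cset {X : Scheme.{0}} [X.Over SpecC] (U : X.Opens) :
    IsOpen (cset (U : Set X)) := by
  -- The zero function with `V = univ` imposes no condition beyond lying in `U`.
  refine TopologicalSpace.isOpen_generateFrom_of_mem ⟨U, 0, Set.univ, isOpen_univ, ?_⟩
  ext p
  constructor
  · intro hp
    refine ⟨IsOpenImmersion.lift U.ι p.1 ?_, IsOpenImmersion.lift_fac .., trivial⟩
    rintro _ ⟨x, rfl⟩
    rw [Subsingleton.elim x (IsLocalRing.closedPoint ℂ)]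
    exact U.range_ι.symm ▸ hp
  · rintro ⟨q, hq, -⟩
    have : p.pt = U.ι (q (IsLocalRing.closedPoint ℂ)) := by
      rw [CPoints.pt, ← hq]
      rfl
    change p.pt ∈ U
    rw [this]
    exact (q (IsLocalRing.closedPoint ℂ)).2

section

variable {X Y : Scheme.{0}} [X.Over SpecC] [Y.Over SpecC]

theorem ReducedDivisor.isClosed_support {Y : Scheme.{0}} (B : ReducedDivisor Y) : IsClosed B.support :=
  B.finite.isClosed_biUnion fun _ _ => isClosed_closure

theorem ReducedDivisor.isOpen_compl_points (B : ReducedDivisor Y) :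
    IsOpen {p : CPoints Y | p ∉ B.points} :=
  isOpen_cset ⟨B.supportᶜ, B.isClosed_support.isOpen_compl⟩

/-- The homeomorphism `Y ∖ B₁ → Y ∖ B₂` obtained by restriction. -/
def restrictComplHomeomorph (h : CPoints Y ≃ₜ CPoints Y) {B₁ B₂ : ReducedDivisor Y}
    (hB : h '' B₁.points = B₂.points) : B₁.Compl ≃ₜ B₂.Compl :=
  h.subtype fun p => by
    rw [← hB, h.injective.mem_set_image]

/-- A homeomorphism of `Y` which matches the homomorphisms `θᵢ` lifts to the induced covers. -/
theorem IsInducedCover.exists_homeomorph [LocallyPathConnectedSpace (CPoints Y)]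
    {G : Type*} [Group G] {B₁ B₂ : ReducedDivisor Y} {y₁ : B₁.Compl} {y₂ : B₂.Compl}
    {θ₁ : FundamentalGroup B₁.Compl y₁ →* G} {θ₂ : FundamentalGroup B₂.Compl y₂ →* G}
    {X₁ X₂ : Scheme.{0}} [X₁.Over SpecC] [X₂.Over SpecC] {φ₁ : X₁ ⟶ Y} {φ₂ : X₂ ⟶ Y}
    [φ₁.IsOver SpecC] [φ₂.IsOver SpecC] (hφ₁ : IsInducedCover φ₁ B₁ θ₁)
    (hφ₂ : IsInducedCover φ₂ B₂ θ₂) (h : CPoints Y ≃ₜ CPoints Y)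
    (hB : h '' B₁.points = B₂.points) (γ : Path (restrictCompl h hB y₁) y₂) (σ : G ≃* G)
    (hσ : (σ.toMonoidHom.comp θ₂).comp (inducedHom h hB γ) = θ₁) :
    ∃ F : B₁.ComplOver φ₁ ≃ₜ B₂.ComplOver φ₂, ∀ z, (F z).1.map φ₂ = h (z.1.map φ₁) := by
  have := hφ₁.pathConnectedSpace
  have := hφ₂.pathConnectedSpace
  have : LocallyPathConnectedSpace B₁.Compl := B₁.isOpen_compl_points.locallyPathConnectedSpace
  have : LocallyPathConnectedSpace B₂.Compl := B₂.isOpen_compl_points.locallyPathConnectedSpace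
  have := hφ₁.isCoveringMap.isLocalHomeomorph.locallyPathConnectedSpace
  have := hφ₂.isCoveringMap.isLocalHomeomorph.locallyPathConnectedSpace
  obtain ⟨x₁, hx₁, hr₁⟩ := hφ₁.exists_range_eq_ker
  obtain ⟨x₂, hx₂, hr₂⟩ := hφ₂.exists_range_eq_ker
  obtain ⟨F, hF⟩ := hφ₁.isCoveringMap.exists_homeomorph_of_mem_range_iff hφ₂.isCoveringMap
    (restrictComplHomeomorph h hB) hx₁ hx₂ γ fun α => by
      rw [hr₁, hr₂, MonoidHom.mem_ker, MonoidHom.mem_ker, ← hσ]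
      exact map_eq_one_iff σ σ.injective
  exact ⟨F, fun z => congrArg Subtype.val (hF z)⟩

theorem connectedNumber_eq_of_homeomorph {B₁ B₂ : ReducedDivisor Y}
    {X₁ X₂ : Scheme.{0}} [X₁.Over SpecC] [X₂.Over SpecC] {φ₁ : X₁ ⟶ Y} {φ₂ : X₂ ⟶ Y}
    [φ₁.IsOver SpecC] [φ₂.IsOver SpecC] (h : CPoints Y ≃ₜ CPoints Y)
    (F : B₁.ComplOver φ₁ ≃ₜ B₂.ComplOver φ₂) (hF : ∀ z, (F z).1.map φ₂ = h (z.1.map φ₁))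
    (C : Set (CPoints Y)) :
    connectedNumber φ₁ B₁ C = connectedNumber φ₂ B₂ (h '' C) := by
  have hF' (z : B₂.ComplOver φ₂) : h ((F.symm z).1.map φ₁) = z.1.map φ₂ := by
    rw [← hF, F.apply_symm_apply]
  let K : (CPoints.map φ₁ ⁻¹' (C \ B₁.points) : Set (CPoints X₁)) ≃ₜ
      (CPoints.map φ₂ ⁻¹' (h '' C \ B₂.points) : Set (CPoints X₂)) :=
    { toFun := fun z => ⟨(F ⟨z.1, z.2.2⟩).1, by
        refine ⟨?_, (F ⟨z.1, z.2.2⟩).2⟩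
        rw [hF]
        exact ⟨_, z.2.1, rfl⟩⟩
      invFun := fun z => ⟨(F.symm ⟨z.1, z.2.2⟩).1, by
        refine ⟨?_, (F.symm ⟨z.1, z.2.2⟩).2⟩
        rw [← h.injective.mem_set_image, hF']
        exact z.2.1⟩
      left_inv := fun z => Subtype.ext
        (congrArg (fun w : B₁.ComplOver φ₁ => w.1) (F.symm_apply_apply ⟨z.1, z.2.2⟩))
      right_inv := fun z => Subtype.ext
        (congrArg (fun w : B₂.ComplOver φ₂ => w.1) (F.apply_symm_apply ⟨z.1, z.2.2⟩))
      continuous_toFun := by fun_prop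
      continuous_invFun := by fun_prop }
  refine ENat.card_congr (K.isQuotientMap.isCoinducing.connectedComponentsHomeomorph
    fun y => ?_).toEquiv
  rw [← K.image_symm, Set.image_singleton]
  exact isConnected_singleton

end

end ConnectedNumber

/-! ### Points of a standard smooth algebra and the implicit function theorem. -/

noncomputable section

theorem MvPolynomial.hasStrictFDerivAt_aeval {𝕜 ι : Type*} [NontriviallyNormedField 𝕜]
    [Fintype ι] (p : MvPolynomial ι 𝕜) (x : ι → 𝕜) :
    HasStrictFDerivAt (fun y : ι → 𝕜 => MvPolynomial.aeval y p)
      (∑ i, MvPolynomial.aeval x (MvPolynomial.pderiv i p) •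
        (ContinuousLinearMap.proj i : (ι → 𝕜) →L[𝕜] 𝕜)) x := by
  classical
  induction p using MvPolynomial.induction_on with
  | C a =>
    refine ((hasStrictFDerivAt_const (𝕜 := 𝕜) a x).congr_fderiv ?_).congr_of_eventuallyEq
      (.of_forall fun y => by simp)
    ext v
    simp
  | add p q hp hq =>
    refine ((hp.add hq).congr_fderiv ?_).congr_of_eventuallyEq (.of_forall fun y => by simp)
    ext v
    simp [add_mul, Finset.sum_add_distrib]
  | mul_X p j hp =>
    have h := hp.mul (ContinuousLinearMap.proj j : (ι → 𝕜) →L[𝕜] 𝕜).hasStrictFDerivAt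
    refine (h.congr_fderiv ?_).congr_of_eventuallyEq (.of_forall fun y => by simp)
    ext v
    have h1 (i : ι) : MvPolynomial.aeval x (MvPolynomial.pderiv i (p * MvPolynomial.X j)) * v i =
        MvPolynomial.aeval x p * (if j = i then v i else 0) +
          x j * (MvPolynomial.aeval x (MvPolynomial.pderiv i p) * v i) := by
      rw [Derivation.leibniz, MvPolynomial.pderiv_X, Pi.single_apply]
      split_ifs <;> simp <;> ring
    simp only [add_apply, smul_apply, sum_apply,
      ContinuousLinearMap.proj_apply, smul_eq_mul, h1, Finset.sum_add_distrib, ← Finset.mul_sum,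
      Finset.sum_ite_eq, Finset.mem_univ, if_true]

theorem MvPolynomial.continuous_aeval_apply {ι : Type*} (p : MvPolynomial ι ℂ) :
    Continuous fun y : ι → ℂ => MvPolynomial.aeval y p := by
  simpa only [MvPolynomial.aeval_eq_eval] using MvPolynomial.continuous_eval p

namespace Algebra.PreSubmersivePresentation

variable {A : Type*} [CommRing A] [Algebra ℂ A] {ι σ : Type*}
  (P : Algebra.PreSubmersivePresentation ℂ A ι σ)

theorem aeval_comp_val (χ : A →ₐ[ℂ] ℂ) (p : MvPolynomial ι ℂ) :
    MvPolynomial.aeval (fun i => χ (P.val i)) p = χ (MvPolynomial.aeval P.val p) := by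
  rw [← AlgHom.comp_apply, MvPolynomial.comp_aeval]

/-- The complex point of `Spec A` with given coordinates satisfying the relations. -/
def algHomOfZero (x : ι → ℂ) (hx : ∀ j, MvPolynomial.aeval x (P.relation j) = 0) : A →ₐ[ℂ] ℂ :=
  AlgHom.liftOfSurjective (MvPolynomial.aeval P.val) P.aeval_val_surjective
    (MvPolynomial.aeval x) <| by
      have h := P.span_range_relation_eq_ker
      rw [P.ker_eq_ker_aeval_val] at h
      change RingHom.ker (MvPolynomial.aeval P.val) ≤ RingHom.ker (MvPolynomial.aeval x)
      rw [← h, Ideal.span_le]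
      rintro _ ⟨j, rfl⟩
      exact hx j

theorem algHomOfZero_aeval (x : ι → ℂ) (hx : ∀ j, MvPolynomial.aeval x (P.relation j) = 0)
    (p : MvPolynomial ι ℂ) :
    P.algHomOfZero x hx (MvPolynomial.aeval P.val p) = MvPolynomial.aeval x p :=
  AlgHom.liftOfSurjective_apply ..

variable [Fintype ι]

/-- The derivative at `x` of the map `ℂ^ι → ℂ^σ` given by the relations. -/
def relationFDeriv (x : ι → ℂ) : (ι → ℂ) →L[ℂ] (σ → ℂ) :=
  .pi fun j => ∑ i, MvPolynomial.aeval x (MvPolynomial.pderiv i (P.relation j)) •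
    (ContinuousLinearMap.proj i : (ι → ℂ) →L[ℂ] ℂ)

theorem hasStrictFDerivAt_relation (x : ι → ℂ) :
    HasStrictFDerivAt (fun y j => MvPolynomial.aeval y (P.relation j)) (P.relationFDeriv x) x :=
  hasStrictFDerivAt_pi.2 fun j => (P.relation j).hasStrictFDerivAt_aeval x

variable [Fintype σ]

/-- The Jacobian is a unit of `A`, so its value under `χ` is nonzero: the derivative is already onto
from the coordinates `P.map i`. -/
theorem range_relationFDeriv_eq_top (hP : IsUnit P.jacobian) (χ : A →ₐ[ℂ] ℂ) :
    (P.relationFDeriv fun i => χ (P.val i)).range = ⊤ := by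
  classical
  rw [LinearMap.range_eq_top]
  intro w
  set M : Matrix σ σ ℂ := P.jacobiMatrix.map (MvPolynomial.aeval fun i => χ (P.val i)) with hM
  have hdet : IsUnit M.det := by
    have h := hP.map χ
    rwa [P.jacobian_eq_jacobiMatrix_det, P.algebraMap_apply, ← P.aeval_comp_val,
      AlgHom.map_det] at h
  refine ⟨∑ i, (M.transpose⁻¹.mulVec w) i • Pi.single (P.map i) (1 : ℂ), ?_⟩
  have h1 : M.transpose.mulVec (M.transpose⁻¹.mulVec w) = w := by
    rw [Matrix.mulVec_mulVec, Matrix.mul_nonsing_inv _ (by rwa [Matrix.det_transpose]),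
      Matrix.one_mulVec]
  ext j
  conv_rhs => rw [← h1]
  rw [map_sum, Finset.sum_apply]
  simp only [Matrix.mulVec, dotProduct]
  refine Finset.sum_congr rfl fun i _ => ?_
  simp [relationFDeriv, hM, P.jacobiMatrix_apply, Pi.single_apply, mul_comm]

end Algebra.PreSubmersivePresentation

namespace ConnectedNumber

/-- The complex points of `Spec A`, as homomorphisms of `ℂ`-algebras. -/
abbrev AlgPoints (A : Type) [CommRing A] [Algebra ℂ A] : Type := A →ₐ[ℂ] ℂ

section

variable (A : Type) [CommRing A] [Algebra ℂ A]

/-- The topology of pointwise convergence. -/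
instance : TopologicalSpace (AlgPoints A) :=
  .induced (fun (χ : A →ₐ[ℂ] ℂ) (a : A) => χ a) inferInstance

variable {A}

theorem continuous_algPoints_apply (a : A) :
    Continuous fun χ : AlgPoints A => χ a :=
  (continuous_apply a).comp continuous_induced_dom

/-- The complex points of a smooth affine variety are locally path connected. -/
theorem locallyPathConnectedSpace_algPoints [Algebra.IsStandardSmooth ℂ A] :
    LocallyPathConnectedSpace (AlgPoints A) := by
  classical
  obtain ⟨ι, σ, _, _, ⟨P⟩⟩ := ‹Algebra.IsStandardSmooth ℂ A›.out
  have := Fintype.ofFinite ι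
  have := Fintype.ofFinite σ
  refine .of_local_retract fun χ₀ => ?_
  let c : AlgPoints A → ι → ℂ := fun χ i => χ (P.val i)
  have hc : Continuous c := continuous_pi fun i => continuous_algPoints_apply _
  have hc0 (χ : AlgPoints A) : (fun j => MvPolynomial.aeval (c χ) (P.relation j)) = 0 := by
    ext j
    exact (P.aeval_comp_val χ _).trans (by rw [P.aeval_val_relation]; exact map_zero _)
  let hF := P.hasStrictFDerivAt_relation (c χ₀)
  let hF' := P.range_relationFDeriv_eq_top P.jacobian_isUnit χ₀
  -- This chart sends `x` to the values of the relations and a kernel coordinate, so the zero set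
  -- becomes the slice with first coordinate `0`.
  let e := hF.implicitToOpenPartialHomeomorph _ _ hF'
  have he (x : ι → ℂ) : (e x).1 = fun j => MvPolynomial.aeval x (P.relation j) :=
    hF.implicitToOpenPartialHomeomorph_fst hF' x
  have hec (χ : AlgPoints A) : (0, (e (c χ)).2) = e (c χ) :=
    Prod.ext ((he _).trans (hc0 χ)).symm rfl
  have hsrc : c χ₀ ∈ e.source := hF.mem_implicitToOpenPartialHomeomorph_source hF'
  let D : Set (P.relationFDeriv (c χ₀)).ker := {z | ((0 : σ → ℂ), z) ∈ e.target}
  -- The default `χ₀` is never used on `D`, where the relations vanish.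
  let g : (P.relationFDeriv (c χ₀)).ker → AlgPoints A := fun z =>
    if hz : ∀ j, MvPolynomial.aeval (e.symm (0, z)) (P.relation j) = 0 then
      P.algHomOfZero (e.symm (0, z)) hz else χ₀
  have hD : IsOpen D := e.open_target.preimage (by fun_prop)
  have hgD (z) (hz : z ∈ D) : ∀ j, MvPolynomial.aeval (e.symm (0, z)) (P.relation j) = 0 := by
    intro j
    have h1 := he (e.symm (0, z))
    rw [e.right_inv hz] at h1
    exact (congrFun h1 j).symm
  refine ⟨(P.relationFDeriv (c χ₀)).ker, inferInstance, ?_, fun χ => (e (c χ)).2, g, D, ?_, ?_,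
    ?_, ?_⟩
  · let _ : NormedSpace ℝ (P.relationFDeriv (c χ₀)).ker := NormedSpace.restrictScalars ℝ ℂ _
    infer_instance
  · refine hD.mem_nhds ?_
    change (0, (e (c χ₀)).2) ∈ e.target
    rw [hec]
    exact e.map_source hsrc
  -- Continuity is tested on each `a`, whose value is that of its polynomial representative `P.σ a`
  -- at the coordinates.
  · rw [IsInducing.continuousOn_iff ⟨rfl⟩, continuousOn_pi]
    intro a
    have h1 : ContinuousOn (fun z : (P.relationFDeriv (c χ₀)).ker =>
        MvPolynomial.aeval (e.symm (0, z)) (P.σ a)) D :=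
      (P.σ a).continuous_aeval_apply.comp_continuousOn
        (e.continuousOn_symm.comp (by fun_prop) fun z hz => hz)
    refine h1.congr fun z hz => ?_
    have h2 : g z = P.algHomOfZero (e.symm (0, z)) (hgD z hz) := dif_pos (hgD z hz)
    change g z a = _
    rw [h2]
    conv_lhs => rw [← P.aeval_val_σ a]
    exact P.algHomOfZero_aeval ..
  · exact continuous_snd.continuousAt.comp ((e.continuousAt hsrc).comp hc.continuousAt)
  · filter_upwards [(hc.tendsto χ₀).eventually (e.open_source.mem_nhds hsrc)] with χ hχ
    have h1 : e.symm (0, (e (c χ)).2) = c χ := by rw [hec, e.left_inv hχ]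
    have h2 : ∀ j, MvPolynomial.aeval (e.symm (0, (e (c χ)).2)) (P.relation j) = 0 := by
      rw [h1]
      exact congrFun (hc0 χ)
    refine (dif_pos h2).trans (AlgHom.ext fun a => ?_)
    rw [← P.aeval_val_σ a, P.algHomOfZero_aeval, h1]
    exact P.aeval_comp_val χ _

end

end ConnectedNumber

/-! ### The classical topology in affine charts. -/

namespace ConnectedNumber

variable {Y : Scheme.{0}}

/-- Evaluation of the sections over `U` at a point of `U`. -/
def evalAt (p : SpecC ⟶ Y) (U : Y.Opens) (h : ⊤ ≤ p ⁻¹ᵁ U) : Γ(Y, U) ⟶ .of ℂ :=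
  p.appLE U ⊤ h ≫ (Scheme.ΓSpecIso (.of ℂ)).hom

theorem evalAt_map (p : SpecC ⟶ Y) {U V : Y.Opens} (i : V ≤ U) (h : ⊤ ≤ p ⁻¹ᵁ V)
    (f : Γ(Y, U)) :
    evalAt p V h (Y.presheaf.map (homOfLE i).op f) = evalAt p U (h.trans (p.preimage_mono i)) f := by
  rw [← CategoryTheory.comp_apply, evalAt, Scheme.Hom.map_appLE_assoc]
  rfl

/-- Evaluating sections of `Y` itself lets functions on different open sets be compared by
restriction. -/
theorem value_eq_evalAt {U : Y.Opens} (q : SpecC ⟶ U.toScheme) (h : ⊤ ≤ (q ≫ U.ι) ⁻¹ᵁ U)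
    (f : Γ(U.toScheme, ⊤)) : value f q = evalAt (q ≫ U.ι) U h (U.topIso.hom f) := by
  have h1 : U.topIso.hom ≫ (q ≫ U.ι).appLE U ⊤ h = q.appTop := by
    rw [← Scheme.Hom.appLE_comp_appLE q U.ι U ⊤ ⊤ (by simp) le_top]
    have h2 : U.topIso.hom ≫ U.ι.appLE U ⊤ (by simp) = 𝟙 _ := by
      simp only [Scheme.Hom.appLE, Scheme.Opens.ι_app, Scheme.Opens.topIso_hom,
        Scheme.Opens.toScheme_presheaf_map]
      exact ((congrArg _ (Y.presheaf.map_comp _ _).symm).trans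
        (Y.presheaf.map_comp _ _).symm).trans (Y.presheaf.map_id _)
    rw [← Category.assoc, h2, Category.id_comp]
    exact q.app_eq_appLE.symm
  rw [value, evalAt, ← h1]
  rfl

theorem mem_iff_top_le_preimage (p : SpecC ⟶ Y) (U : Y.Opens) :
    p (IsLocalRing.closedPoint ℂ) ∈ U ↔ ⊤ ≤ p ⁻¹ᵁ U := by
  constructor
  · intro h x _
    rw [Subsingleton.elim x (IsLocalRing.closedPoint ℂ)]
    exact h
  · intro h
    exact h trivial

theorem evalAt_ne_zero_iff (p : SpecC ⟶ Y) (U : Y.Opens) (h : ⊤ ≤ p ⁻¹ᵁ U) (f : Γ(Y, U)) :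
    evalAt p U h f ≠ 0 ↔ p (IsLocalRing.closedPoint ℂ) ∈ Y.basicOpen f := by
  have h1 : SpecC.basicOpen (p.appLE U ⊤ h f) = p ⁻¹ᵁ Y.basicOpen f := by
    rw [Scheme.basicOpen_appLE, top_inf_eq]
  rw [mem_iff_top_le_preimage, ← h1, top_le_iff]
  have h2 : evalAt p U h f = (Scheme.ΓSpecIso (.of ℂ)).commRingCatIsoToRingEquiv
    (p.appLE U ⊤ h f) := rfl
  rw [h2]
  generalize p.appLE U ⊤ h f = x
  rw [map_ne_zero_iff _ (RingEquiv.injective _)]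
  constructor
  · intro hx
    refine Scheme.basicOpen_of_isUnit _ ?_
    rw [← MulEquiv.isUnit_map (Scheme.ΓSpecIso (.of ℂ)).commRingCatIsoToRingEquiv]
    exact isUnit_iff_ne_zero.2 ((map_ne_zero_iff _ (RingEquiv.injective _)).2 hx)
  · rintro hx rfl
    rw [Scheme.basicOpen_zero] at hx
    exact bot_ne_top hx

theorem SpecMap_evalAt_fromSpec (p : SpecC ⟶ Y) {U : Y.Opens} (hU : IsAffineOpen U)
    (h : ⊤ ≤ p ⁻¹ᵁ U) : Spec.map (evalAt p U h) ≫ hU.fromSpec = p := by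
  rw [evalAt, Spec.map_comp, Category.assoc,
    IsAffineOpen.SpecMap_appLE_fromSpec p hU (isAffineOpen_top SpecC) h,
    IsAffineOpen.fromSpec_top, Scheme.isoSpec_Spec_inv, ← Category.assoc, ← Spec.map_comp]
  simp

theorem evalAt_mul_pow {U V : Y.Opens} {s : Γ(Y, V)} (hs : Y.basicOpen s ≤ U) (f : Γ(Y, U))
    (a : Γ(Y, V)) (n : ℕ)
    (hf : Y.presheaf.map (homOfLE hs).op f * Y.presheaf.map (homOfLE (Y.basicOpen_le s)).op s ^ n =
      Y.presheaf.map (homOfLE (Y.basicOpen_le s)).op a)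
    (p : SpecC ⟶ Y) (h : ⊤ ≤ p ⁻¹ᵁ Y.basicOpen s) :
    evalAt p U (h.trans (p.preimage_mono hs)) f *
      evalAt p V (h.trans (p.preimage_mono (Y.basicOpen_le s))) s ^ n =
      evalAt p V (h.trans (p.preimage_mono (Y.basicOpen_le s))) a := by
  rw [← evalAt_map p hs h, ← evalAt_map p (Y.basicOpen_le s) h,
    ← evalAt_map p (Y.basicOpen_le s) h, ← hf, map_mul, map_pow]

/-- Sections over a basic open subset of an affine `V` are fractions with denominator a power of
`s`. Hence a regular function on any `U` is locally a quotient of functions on `V`. -/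
theorem exists_mul_pow_eq {U V : Y.Opens} (hV : IsAffineOpen V) {s : Γ(Y, V)}
    (hs : Y.basicOpen s ≤ U) (f : Γ(Y, U)) : ∃ (a : Γ(Y, V)) (n : ℕ),
    Y.presheaf.map (homOfLE hs).op f * Y.presheaf.map (homOfLE (Y.basicOpen_le s)).op s ^ n =
      Y.presheaf.map (homOfLE (Y.basicOpen_le s)).op a := by
  have := hV.isLocalization_basicOpen s
  obtain ⟨n, a, h⟩ := IsLocalization.Away.surj s (Y.presheaf.map (homOfLE hs).op f)
  exact ⟨a, n, h⟩

variable [Y.Over SpecC]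

theorem mem_basicSet_iff (p : CPoints Y) (U : Y.Opens) (f : Γ(U.toScheme, ⊤)) (V : Set ℂ) :
    p ∈ basicSet U f V ↔ ∃ h : ⊤ ≤ p.1 ⁻¹ᵁ U, evalAt p.1 U h (U.topIso.hom f) ∈ V := by
  constructor
  · rintro ⟨q, hq, hV⟩
    have h : ⊤ ≤ (q ≫ U.ι) ⁻¹ᵁ U := fun x _ => (q x).2
    rw [value_eq_evalAt q h] at hV
    obtain ⟨p, hp⟩ := p
    subst hq
    exact ⟨h, hV⟩
  · rintro ⟨h, hV⟩
    obtain ⟨p, hp⟩ := p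
    obtain ⟨q, rfl⟩ : ∃ q : SpecC ⟶ U.toScheme, q ≫ U.ι = p := by
      refine ⟨IsOpenImmersion.lift U.ι p ?_, IsOpenImmersion.lift_fac ..⟩
      rintro _ ⟨x, rfl⟩
      exact U.range_ι.symm ▸ h (x := x) trivial
    exact ⟨q, rfl, by rwa [value_eq_evalAt q h]⟩

/-- The constant functions on `U`. -/
def const (U : Y.Opens) : CommRingCat.of ℂ ⟶ Γ(Y, U) :=
  (Scheme.ΓSpecIso (.of ℂ)).inv ≫ (Y ↘ SpecC).appLE ⊤ U le_top

theorem SpecMap_const {U : Y.Opens} (hU : IsAffineOpen U) :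
    Spec.map (const U) = hU.fromSpec ≫ (Y ↘ SpecC) := by
  rw [← IsAffineOpen.SpecMap_appLE_fromSpec (Y ↘ SpecC) (isAffineOpen_top SpecC) hU le_top,
    IsAffineOpen.fromSpec_top, Scheme.isoSpec_Spec_inv, ← Spec.map_comp]
  rfl

theorem const_evalAt {U : Y.Opens} (hU : IsAffineOpen U) (p : CPoints Y) (h : ⊤ ≤ p.1 ⁻¹ᵁ U) :
    const U ≫ evalAt p.1 U h = 𝟙 _ := by
  apply Spec.map_injective
  rw [Spec.map_comp, SpecMap_const hU, ← Category.assoc, SpecMap_evalAt_fromSpec, p.2, Spec.map_id]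

/-- The complex point of an affine open set given by a homomorphism. -/
def CPoints.ofHom {U : Y.Opens} (hU : IsAffineOpen U) (χ : Γ(Y, U) ⟶ .of ℂ)
    (hχ : const U ≫ χ = 𝟙 _) : CPoints Y :=
  ⟨Spec.map χ ≫ hU.fromSpec, by
    rw [Category.assoc, ← SpecMap_const hU, ← Spec.map_comp, hχ, Spec.map_id]⟩

theorem CPoints.top_le_preimage_ofHom {U : Y.Opens} (hU : IsAffineOpen U) (χ : Γ(Y, U) ⟶ .of ℂ)
    (hχ : const U ≫ χ = 𝟙 _) : ⊤ ≤ (CPoints.ofHom hU χ hχ).1 ⁻¹ᵁ U := by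
  rw [← mem_iff_top_le_preimage]
  exact hU.range_fromSpec.subset ⟨Spec.map χ (IsLocalRing.closedPoint ℂ), rfl⟩

theorem CPoints.evalAt_ofHom {U : Y.Opens} (hU : IsAffineOpen U) (χ : Γ(Y, U) ⟶ .of ℂ)
    (hχ : const U ≫ χ = 𝟙 _) (h) : evalAt (CPoints.ofHom hU χ hχ).1 U h = χ := by
  apply Spec.map_injective
  rw [← cancel_mono hU.fromSpec, SpecMap_evalAt_fromSpec]
  rfl

/-- The default `z` only makes evaluation total; preimages of open sets within `U(ℂ)` are generators
of the topology. -/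
theorem continuousOn_evalAt (U : Y.Opens) (f : Γ(Y, U)) (z : ℂ)
    [DecidablePred fun p : CPoints Y => ⊤ ≤ p.1 ⁻¹ᵁ U] :
    ContinuousOn (fun p : CPoints Y => if h : ⊤ ≤ p.1 ⁻¹ᵁ U then evalAt p.1 U h f else z)
      (cset (U : Set Y)) := by
  rw [continuousOn_open_iff (isOpen_cset U)]
  intro V hV
  refine TopologicalSpace.isOpen_generateFrom_of_mem ⟨U, U.topIso.inv f, V, hV, ?_⟩
  ext p
  rw [mem_basicSet_iff]
  have h1 : U.topIso.hom (U.topIso.inv f) = f := Iso.inv_hom_id_apply _ _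
  rw [h1]
  constructor
  · rintro ⟨h, hV⟩
    have h := (mem_iff_top_le_preimage p.1 U).1 h
    exact ⟨h, by simpa [h] using hV⟩
  · rintro ⟨h, hV⟩
    refine ⟨(mem_iff_top_le_preimage p.1 U).2 h, ?_⟩
    simpa [h] using hV

/-- Near `y`, the classical topology is that of pointwise convergence on the algebra of a standard
smooth affine chart `V`: evaluation and `CPoints.ofHom` are mutually inverse and continuous there.
-/
theorem locallyPathConnectedSpace_cPoints [Smooth (Y ↘ SpecC)] :
    LocallyPathConnectedSpace (CPoints Y) := by
  classical
  refine .of_local_retract fun y => ?_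
  obtain ⟨U, hU, V, hV, hyV, e, hsm⟩ := Smooth.exists_isStandardSmooth (Y ↘ SpecC) y.pt
  have hUtop : U = ⊤ := by
    refine top_le_iff.1 fun x _ => ?_
    rw [Subsingleton.elim x ((Y ↘ SpecC) y.pt)]
    exact e hyV
  subst hUtop
  let : Algebra ℂ Γ(Y, V) := (const V).hom.toAlgebra
  have : Algebra.IsStandardSmooth ℂ Γ(Y, V) :=
    RingHom.isStandardSmooth_respectsIso.2 _
      (Scheme.ΓSpecIso (.of ℂ)).symm.commRingCatIsoToRingEquiv hsm
  have hconst (χ : AlgPoints Γ(Y, V)) : const V ≫ CommRingCat.ofHom χ.toRingHom = 𝟙 _ := by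
    ext z
    exact χ.commutes z
  let g : AlgPoints Γ(Y, V) → CPoints Y := fun χ =>
    CPoints.ofHom hV (CommRingCat.ofHom χ.toRingHom) (hconst χ)
  have hgV (χ : AlgPoints Γ(Y, V)) : ⊤ ≤ (g χ).1 ⁻¹ᵁ V := CPoints.top_le_preimage_ofHom ..
  have hev (χ : AlgPoints Γ(Y, V)) (a : Γ(Y, V)) : evalAt (g χ).1 V (hgV χ) a = χ a := by
    rw [CPoints.evalAt_ofHom]
    rfl
  have hg : Continuous g := by
    refine continuous_generateFrom_iff.2 ?_
    rintro _ ⟨U, f, W, hW, rfl⟩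
    refine isOpen_iff_mem_nhds.2 fun χ₀ hχ₀ => ?_
    obtain ⟨h, hfW⟩ := (mem_basicSet_iff _ _ _ _).1 hχ₀
    -- The open set `U` need not lie in `V`; on a basic open subset of `V` inside `U`, the function
    -- is `a / s ^ n`, which is continuous where `s` does not vanish.
    obtain ⟨s, hsU, hs⟩ := hV.exists_basicOpen_le
      ⟨(g χ₀).pt, (mem_iff_top_le_preimage _ _).2 h⟩ ((mem_iff_top_le_preimage _ _).2 (hgV χ₀))
    obtain ⟨a, n, hf⟩ := exists_mul_pow_eq hV hsU (U.topIso.hom f)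
    have hmem (χ : AlgPoints Γ(Y, V)) : χ s ≠ 0 ↔ ⊤ ≤ (g χ).1 ⁻¹ᵁ Y.basicOpen s := by
      rw [← hev, evalAt_ne_zero_iff, mem_iff_top_le_preimage]
    have hval (χ : AlgPoints Γ(Y, V)) (hχ : χ s ≠ 0) :
        evalAt (g χ).1 U (((hmem χ).1 hχ).trans ((g χ).1.preimage_mono hsU)) (U.topIso.hom f) =
          χ a / χ s ^ n := by
      rw [eq_div_iff (pow_ne_zero _ hχ)]
      have h1 := evalAt_mul_pow hsU _ a n hf _ ((hmem χ).1 hχ)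
      rwa [hev, hev] at h1
    have hs0 : χ₀ s ≠ 0 := (hmem χ₀).2 ((mem_iff_top_le_preimage _ _).1 hs)
    have hc : ContinuousAt (fun χ : AlgPoints Γ(Y, V) => χ a / χ s ^ n) χ₀ :=
      (continuous_algPoints_apply a).continuousAt.div
        ((continuous_algPoints_apply s).pow n).continuousAt (pow_ne_zero _ hs0)
    have hW' : ∀ᶠ χ : AlgPoints Γ(Y, V) in 𝓝 χ₀, χ a / χ s ^ n ∈ W :=
      hc.eventually (hW.mem_nhds ((hval χ₀ hs0).symm ▸ hfW :))
    filter_upwards [hW', (continuous_algPoints_apply s).continuousAt.eventually_ne hs0] with χ h1 h2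
    exact (mem_basicSet_iff _ _ _ _).2 ⟨_, hval χ h2 ▸ h1⟩
  let ev (p : CPoints Y) (h : ⊤ ≤ p.1 ⁻¹ᵁ V) : AlgPoints Γ(Y, V) :=
    { (evalAt p.1 V h).hom with
      commutes' := fun z => congr($(const_evalAt hV p h).hom z) }
  have hy := (mem_iff_top_le_preimage y.1 V).1 hyV
  let f : CPoints Y → AlgPoints Γ(Y, V) := fun p =>
    if h : ⊤ ≤ p.1 ⁻¹ᵁ V then ev p h else ev y hy
  have hmem : ∀ᶠ p in 𝓝 y, p ∈ cset (V : Set Y) := (isOpen_cset V).mem_nhds hyV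
  refine ⟨AlgPoints Γ(Y, V), inferInstance, locallyPathConnectedSpace_algPoints, f, g, Set.univ,
    univ_mem, hg.continuousOn, ?_, ?_⟩
  · rw [IsInducing.continuousAt_iff ⟨rfl⟩, continuousAt_pi]
    intro a
    refine ((continuousOn_evalAt V a (evalAt y.1 V hy a)).continuousAt hmem).congr
      (.of_forall fun p => ?_)
    simp only [f, Function.comp]
    split_ifs <;> rfl
  · filter_upwards [hmem] with p hp
    have hp' := (mem_iff_top_le_preimage p.1 V).1 hp
    have h1 : f p = ev p hp' := dif_pos hp'
    rw [h1]
    exact Subtype.ext (SpecMap_evalAt_fromSpec p.1 hV hp')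

end ConnectedNumber
end

theorem mainTheorem5
    {Y : AlgebraicGeometry.Scheme.{0}} [Y.Over ConnectedNumber.SpecC]
    [ConnectedNumber.IsVariety Y] [AlgebraicGeometry.Smooth (Y ↘ ConnectedNumber.SpecC)]
    {G : Type*} [Group G] [Finite G]
    (B₁ B₂ : ConnectedNumber.ReducedDivisor Y)
    {y₁ : B₁.Compl} {y₂ : B₂.Compl}
    (θ₁ : FundamentalGroup B₁.Compl y₁ →* G) (hθ₁ : Function.Surjective θ₁)
    (θ₂ : FundamentalGroup B₂.Compl y₂ →* G) (hθ₂ : Function.Surjective θ₂)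
    {X₁ X₂ : AlgebraicGeometry.Scheme.{0}}
    [X₁.Over ConnectedNumber.SpecC] [X₂.Over ConnectedNumber.SpecC]
    (φ₁ : X₁ ⟶ Y) (φ₂ : X₂ ⟶ Y)
    [φ₁.IsOver ConnectedNumber.SpecC] [φ₂.IsOver ConnectedNumber.SpecC]
    (hφ₁ : ConnectedNumber.IsInducedCover φ₁ B₁ θ₁)
    (hφ₂ : ConnectedNumber.IsInducedCover φ₂ B₂ θ₂)
    (C₁ : Set Y) (hC₁ : IsClosed C₁)
    (hC₁B₁ : ∀ Z : Set Y, ConnectedNumber.IsIrreducibleComponentOf Z C₁ → ¬ Z ⊆ B₁.support)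
    (hconn : IsConnected (ConnectedNumber.cset C₁ \ B₁.points))
    (h : ConnectedNumber.CPoints Y ≃ₜ ConnectedNumber.CPoints Y)
    (hB : h '' B₁.points = B₂.points)
    (γ : Path (ConnectedNumber.restrictCompl h hB y₁) y₂)
    (σ : G ≃* G)
    (hσ : (σ.toMonoidHom.comp θ₂).comp (ConnectedNumber.inducedHom h hB γ) = θ₁) :
    ConnectedNumber.connectedNumber φ₁ B₁ (ConnectedNumber.cset C₁) =
      ConnectedNumber.connectedNumber φ₂ B₂ (h '' ConnectedNumber.cset C₁) := by
  have : LocallyPathConnectedSpace (ConnectedNumber.CPoints Y) :=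
    ConnectedNumber.locallyPathConnectedSpace_cPoints
  obtain ⟨F, hF⟩ := hφ₁.exists_homeomorph hφ₂ h hB γ σ hσ
  exact ConnectedNumber.connectedNumber_eq_of_homeomorph h F hF _
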